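/- All logarithms are to base $2$; for an integer $n\ge 3$ put $\varepsilon(n) := 1/(\log\log n)^{1/50}$. An $n$-party full-information coin-flipping protocol $\Pi$ with $\ell$ rounds is given as follows: in each round a single party, determined by the public transcript of the messages broadcast so far, broadcasts a message drawn from a discrete distribution determined by that transcript (the parties keep no private state); after $\ell$ rounds the common output is a deterministic Boolean function of the full transcript. A $t$-adaptive adversary for $\Pi$ is a (possibly randomized, computationally unbounded) strategy that, before each round and as a function of the transcript so far and its own private randomness, may add the party about to speak to the list of corrupted parties, provided that in every execution this list has at most $t$ members; whenever a corrupted party speaks, the adversary chooses the message it sends, which must lie in the support of the honest distribution of that message given the transcript so far. Let $\mathbb{E}[\Pi_{\mathsf A}]$ be the expected output of $\Pi$ when attacked by $\mathsf A$. **Theorem.** There is a universal constant $C>0$ such that for every $n\ge 3$, every $\ell \ge 0$, and every $n$-party, $\ell$-round full-information coin-flipping protocol $\Pi$ there is a $\left(C\sqrt n\,\log^3 n\right)$-adaptive adversary $\mathsf A$ for $\Pi$ with $$\mathbb{E}[\Pi_{\mathsf A}] \le \varepsilon(n) \qquad\text{or}\qquad \mathbb{E}[\Pi_{\mathsf A}]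 \ge 1 - C\,\varepsilon(n).$$ -/

import Mathlib

namespace CoinFlip

noncomputable section

/-- A (stateless) full-information coin-flipping protocol with `n` parties and messages in `M`.
In every round a single party, determined by the public partial transcript, broadcasts a message
whose distribution is determined by the public partial transcript; the common output is a
deterministic Boolean function of the full transcript.
Partial transcripts are lists of messages with the most recent message first. Only lists of length
less than `rounds` (for `party` and `next`) or equal to `rounds` (for `output`) are ever used.
Messages are discrete: every `PMF` has countable support. -/
structure Protocol (n : ℕ) (M : Type) where
  /-- the number of rounds -/
  rounds : ℕ
  /-- the party that speaks next, after the given partial transcript -/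
  party : List M → Fin n
  /-- the honest distribution of the next message, after the given partial transcript -/
  next : List M → PMF M
  /-- the common output -/
  output : List M → Bool

/-- A (possibly randomized, computationally unbounded) adversary for the protocol `P`.
Its view after some rounds is the list, most recent round first, of the pairs
(its own private coins of that round, the message broadcast in that round).
Before each round it draws fresh private coins, as a function of its view. From its view and the
new coins, hence before the message of the round is determined, it decides whether to add the party
that is about to speak to the corrupted list, and which message that party has to send
if it is corrupted (now or since an earlier round). -/
structure Adversary {n : ℕ} {M : Type} (P : Protocol n M) where
  Coin : Type
  toss : List (Coin × M) → PMF Coin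
  corrupt : List (Coin × M) → Coin → Bool
  send : List (Coin × M) → Coin → M

namespace Adversary

variable {n : ℕ} {M : Type} {P : Protocol n M} (A : Adversary P)

/-- The public transcript contained in a view. -/
def transcript (v : List (A.Coin × M)) : List M := v.map Prod.snd

/-- The party that is about to speak, given the adversary's view. -/
def speaker (v : List (A.Coin × M)) : Fin n := P.party (A.transcript v)

/-- The list of corrupted parties after the rounds recorded in a view. -/
def corrupted : List (A.Coin × M) → Finset (Fin n)
  | [] => ∅
  | (r, _) :: v => if A.corrupt v r then insert (A.speaker v) (corrupted v) else corrupted v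

/-- The list of corrupted parties at the time the next message is sent: the view of the previous
rounds is `v` and the coins of the current round are `r`. -/
def corruptedNow (v : List (A.Coin × M)) (r : A.Coin) : Finset (Fin n) :=
  if A.corrupt v r then insert (A.speaker v) (A.corrupted v) else A.corrupted v

/-- The distribution of the next message in the attacked execution: a corrupted party sends the
message that the adversary chooses, an honest one follows the protocol. -/
def message (v : List (A.Coin × M)) (r : A.Coin) : PMF M :=
  if A.speaker v ∈ A.corruptedNow v r then PMF.pure (A.send v r) else P.next (A.transcript v)

/-- The distribution of the adversary's view after the given number of rounds of the attacked
execution. -/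
def viewDist : ℕ → PMF (List (A.Coin × M))
  | 0 => PMF.pure []
  | i + 1 => (viewDist i).bind fun v =>
      (A.toss v).bind fun r => (A.message v r).map fun m => (r, m) :: v

/-- `A` is a `t`-adaptive adversary: in every execution, it never corrupts more than `t` parties,
and the messages it sends on behalf of corrupted parties are valid, i.e. in the support of the
honest distribution of the message, given the partial transcript. -/
def IsAdaptive (t : ℝ) : Prop :=
  (∀ v ∈ (A.viewDist P.rounds).support, ((A.corrupted v).card : ℝ) ≤ t) ∧
  (∀ i < P.rounds, ∀ v ∈ (A.viewDist i).support, ∀ r ∈ (A.toss v).support,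
    A.speaker v ∈ A.corruptedNow v r → A.send v r ∈ (P.next (A.transcript v)).support)

/-- The expected outcome of the attacked protocol, i.e. the probability that its output is one. -/
def expectedOutcome : ℝ :=
  (((A.viewDist P.rounds).map fun v => P.output (A.transcript v)) true).toReal

end Adversary

/-- `ε = 1 / (log log n)^{1/50}`, with logarithms to base two. -/
def epsilon (n : ℕ) : ℝ := 1 / (Real.logb 2 (Real.logb 2 n)) ^ ((1 : ℝ) / 50)

end

end CoinFlip

/-! Replace the hard corruption budget by a price `lam` per corrupted party. When `lam * t ≥ 1`, a
corruption beyond the budget leaves no positive value, so an optimal player of the priced game can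
be stopped at `t` corruptions (`exists_adversary_value_le`).

Let V be one minus the value of the downward game with nobody corrupted. If V is small at the root,
the downward player wins. Otherwise V guides an upward attack: under honest play V does not decrease
on average, and no message lowers it by more than `lam`, since the downward player could have bought
the speaker and sent that message.

The upward attack multiplies the honest probability of each message by `1 + η * Y`, where `Y ≥ -lam`
is a mean-zero minorant of the increment of V. This factor is at least `1 - η * lam`, so the speaker
can stay honest with nearly that probability, and corruption supplies the rest. Given the
transcript, the corruptions of different parties remain independent, and Bayes' rule updates only
the speaker's (`mix`, `ex_tilt_le_value`).

A potential bounds both the failure probability and the expected price. The tilt drives V upwards,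
so `exp(-(η / 2) * V)` controls failure. A party may speak often, and its corruption probability
then fluctuates with quadratic growth of order `(η * Y) ^ 2`; the tilted drift `η * Y ^ 2` of V,
whose total is at most 1, pays for this whatever the number of rounds
(`exists_tilt_mul_potential_le`). Backward induction gives `one_sub_potential_le_mix`. -/

namespace CoinFlip

noncomputable section

/-! Expectations of bounded real functions under a discrete distribution. -/

/-- The expectation of a real function under a discrete distribution. -/
def ex {α : Type*} (p : PMF α) (f : α → ℝ) : ℝ := ∑' a, (p a).toReal * f a

section Expectation

variable {α β : Type*} (p : PMF α) {f g : α → ℝ}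

theorem summable_toReal : Summable fun a => (p a).toReal :=
  ENNReal.summable_toReal p.tsum_coe_ne_top

theorem tsum_toReal : ∑' a, (p a).toReal = 1 := by
  rw [← ENNReal.tsum_toReal_eq fun a => p.apply_ne_top a, p.tsum_coe, ENNReal.toReal_one]

theorem summable_ex {B : ℝ} (hf : ∀ a, |f a| ≤ B) : Summable fun a => (p a).toReal * f a := by
  refine Summable.of_norm_bounded ((summable_toReal p).mul_right B) fun a => ?_
  rw [norm_mul, Real.norm_eq_abs, Real.norm_eq_abs, abs_of_nonneg ENNReal.toReal_nonneg]
  exact mul_le_mul_of_nonneg_left (hf a) ENNReal.toReal_nonneg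

theorem ex_const (c : ℝ) : ex p (fun _ => c) = c := by
  rw [ex, tsum_mul_right, tsum_toReal, one_mul]

theorem ex_const_mul (c : ℝ) : ex p (fun a => c * f a) = c * ex p f := by
  rw [ex, ex, ← tsum_mul_left]
  exact tsum_congr fun a => by ring

theorem ex_add {B D : ℝ} (hf : ∀ a, |f a| ≤ B) (hg : ∀ a, |g a| ≤ D) :
    ex p (fun a => f a + g a) = ex p f + ex p g := by
  rw [ex, ex, ex, ← (summable_ex p hf).tsum_add (summable_ex p hg)]
  exact tsum_congr fun a => by ring

theorem ex_congr (h : ∀ a ∈ p.support, f a = g a) : ex p f = ex p g := by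
  refine tsum_congr fun a => ?_
  by_cases ha : a ∈ p.support
  · rw [h a ha]
  · rw [PMF.mem_support_iff, not_not] at ha
    simp [ha]

theorem ex_mono {B D : ℝ} (hf : ∀ a, |f a| ≤ B) (hg : ∀ a, |g a| ≤ D)
    (h : ∀ a ∈ p.support, f a ≤ g a) : ex p f ≤ ex p g := by
  refine (summable_ex p hf).tsum_le_tsum (fun a => ?_) (summable_ex p hg)
  by_cases ha : a ∈ p.support
  · exact mul_le_mul_of_nonneg_left (h a ha) ENNReal.toReal_nonneg
  · rw [PMF.mem_support_iff, not_not] at ha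
    simp [ha]

theorem ex_le_const {B c : ℝ} (hf : ∀ a, |f a| ≤ B) (h : ∀ a ∈ p.support, f a ≤ c) :
    ex p f ≤ c := by
  simpa only [ex_const] using ex_mono p hf (g := fun _ => c) (fun _ => le_rfl) h

theorem ex_sum {ι : Type*} (s : Finset ι) (F : ι → α → ℝ) {B : ι → ℝ}
    (hF : ∀ j a, |F j a| ≤ B j) :
    ex p (fun a => ∑ j ∈ s, F j a) = ∑ j ∈ s, ex p (F j) := by
  simp only [ex, Finset.mul_sum]
  exact Summable.tsum_finsetSum fun j _ => summable_ex p (hF j)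

theorem ex_pure (a : α) (f : α → ℝ) : ex (PMF.pure a) f = f a := by
  rw [ex, tsum_eq_single a]
  · simp
  · intro b hb
    simp [PMF.pure_apply, hb]

/-- Passing to `ENNReal` lets sums be interchanged in `ex_bind` without a summability argument. -/
theorem ofReal_ex {B : ℝ} (h0 : ∀ a, 0 ≤ f a) (hB : ∀ a, f a ≤ B) :
    ENNReal.ofReal (ex p f) = ∑' a, p a * ENNReal.ofReal (f a) := by
  rw [ex, ENNReal.ofReal_tsum_of_nonneg (fun a => mul_nonneg ENNReal.toReal_nonneg (h0 a))
    (summable_ex p fun a => (abs_of_nonneg (h0 a)).trans_le (hB a))]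
  refine tsum_congr fun a => ?_
  rw [ENNReal.ofReal_mul ENNReal.toReal_nonneg, ENNReal.ofReal_toReal (p.apply_ne_top a)]

theorem ex_nonneg (h0 : ∀ a, 0 ≤ f a) : 0 ≤ ex p f :=
  tsum_nonneg fun a => mul_nonneg ENNReal.toReal_nonneg (h0 a)

theorem ex_bind (q : α → PMF β) {f : β → ℝ} {B : ℝ} (h0 : ∀ b, 0 ≤ f b) (hB : ∀ b, f b ≤ B) :
    ex (p.bind q) f = ex p fun a => ex (q a) f := by
  have hb : ∀ b, |f b| ≤ B := fun b => (abs_of_nonneg (h0 b)).trans_le (hB b)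
  rw [← ENNReal.ofReal_eq_ofReal_iff (ex_nonneg _ h0) (ex_nonneg _ fun a => ex_nonneg _ h0),
    ofReal_ex _ h0 hB, ofReal_ex _ (fun a => ex_nonneg _ h0)
      (fun _ => ex_le_const _ hb fun b _ => hB b)]
  simp_rw [ofReal_ex _ h0 hB, PMF.bind_apply, ← ENNReal.tsum_mul_right, ← ENNReal.tsum_mul_left]
  rw [ENNReal.tsum_comm]
  simp only [mul_assoc]

theorem ex_map (q : α → β) {f : β → ℝ} {B : ℝ} (h0 : ∀ b, 0 ≤ f b) (hB : ∀ b, f b ≤ B) :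
    ex (p.map q) f = ex p fun a => f (q a) := by
  rw [PMF.map, ex_bind p _ h0 hB]
  simp only [Function.comp_apply, ex_pure]

theorem map_apply_toReal (o : α → Bool) (b : Bool) :
    ((p.map o) b).toReal = ex p fun a => if o a = b then 1 else 0 := by
  rw [PMF.map_apply, ENNReal.tsum_toReal_eq]
  · refine tsum_congr fun a => ?_
    by_cases h : o a = b
    · simp [h]
    · simp [h, Ne.symm h]
  · intro a
    split_ifs
    · exact p.apply_ne_top a
    · exact ENNReal.zero_ne_top

end Expectation

/-! The value of the game in which the adversary pays for every corrupted party. -/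

section Value

variable {n : ℕ} {M : Type} (P : Protocol n M) (lam : ℝ) (G : List M → ℝ)

/-- The optimal expected value of `G` minus `lam` times the number of corrupted parties, when `k`
rounds are left, the transcript is `x` and the parties in `C` are corrupted. -/
def value : ℕ → List M → Finset (Fin n) → ℝ
  | 0, x, C => G x - lam * C.card
  | k + 1, x, C =>
    if P.party x ∈ C then ⨆ m : (P.next x).support, value k (m :: x) C
    else max (ex (P.next x) fun m => value k (m :: x) C)
      (⨆ m : (P.next x).support, value k (m :: x) (insert (P.party x) C))

variable {G} {lam}

theorem nonempty_support (p : PMF M) : Nonempty p.support := p.support_nonempty.to_subtype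

/-- The upper bound is what turns the price into a hard budget: it is nonpositive once `lam * C.card
≥ 1`. -/
theorem value_bounds (hl : 0 ≤ lam) (hG0 : ∀ x, 0 ≤ G x) (hG1 : ∀ x, G x ≤ 1) (k : ℕ) :
    ∀ x C, -(lam * n) ≤ value P lam G k x C ∧ value P lam G k x C ≤ 1 - lam * C.card := by
  induction k with
  | zero =>
    intro x C
    have hC : lam * (C.card : ℝ) ≤ lam * n :=
      mul_le_mul_of_nonneg_left (by exact_mod_cast (card_finset_fin_le C)) hl
    simp only [value]
    constructor <;> linarith [hG0 x, hG1 x]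
  | succ k ih =>
    intro x C
    have := nonempty_support (P.next x)
    have hbd : ∀ D, BddAbove (Set.range fun m : (P.next x).support => value P lam G k (m :: x) D) :=
      fun D => ⟨1 - lam * D.card, by rintro _ ⟨m, rfl⟩; exact (ih _ _).2⟩
    obtain ⟨m₀⟩ := nonempty_support (P.next x)
    simp only [value]
    split_ifs with h
    · exact ⟨(ih _ _).1.trans (le_ciSup (hbd C) m₀), ciSup_le fun _ => (ih _ _).2⟩
    · refine ⟨((ih _ _).1.trans (le_ciSup (hbd _) m₀)).trans (le_max_right _ _),
        max_le ?_ (ciSup_le fun m => (ih _ _).2.trans ?_)⟩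
      · refine ex_le_const _ (B := max (1 - lam * C.card) (lam * n)) (fun m => ?_)
          fun m _ => (ih _ _).2
        rw [abs_le]
        have h1 := ih (m :: x) C
        exact ⟨by linarith [le_max_right (1 - lam * (C.card : ℝ)) (lam * n)],
          h1.2.trans (le_max_left _ _)⟩
      · have : (C.card : ℝ) ≤ (insert (P.party x) C).card := by
          exact_mod_cast Finset.card_le_card (Finset.subset_insert _ _)
        nlinarith

/-- A uniform bound for the values of the game. -/
theorem abs_value_le (hl : 0 ≤ lam) (hG0 : ∀ x, 0 ≤ G x) (hG1 : ∀ x, G x ≤ 1) (k : ℕ)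
    (x : List M) (C : Finset (Fin n)) : |value P lam G k x C| ≤ 1 + lam * n := by
  have h := value_bounds P hl hG0 hG1 k x C
  have h1 : 0 ≤ lam * (C.card : ℝ) := by positivity
  have h2 : 0 ≤ lam * (n : ℝ) := by positivity
  rw [abs_le]
  constructor <;> linarith

theorem bddAbove_value (hl : 0 ≤ lam) (hG0 : ∀ x, 0 ≤ G x) (hG1 : ∀ x, G x ≤ 1) (k : ℕ)
    (x : List M) (C : Finset (Fin n)) :
    BddAbove (Set.range fun m : (P.next x).support => value P lam G k (m :: x) C) :=
  ⟨1 + lam * n, by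
    rintro _ ⟨m, rfl⟩
    exact (le_abs_self _).trans (abs_value_le P hl hG0 hG1 k _ C)⟩

theorem value_le_iSup (hl : 0 ≤ lam) (hG0 : ∀ x, 0 ≤ G x) (hG1 : ∀ x, G x ≤ 1) (k : ℕ)
    (x : List M) (C : Finset (Fin n)) {m : M} (hm : m ∈ (P.next x).support) :
    value P lam G k (m :: x) C ≤ ⨆ m : (P.next x).support, value P lam G k (m :: x) C :=
  le_ciSup (bddAbove_value P hl hG0 hG1 k x C) ⟨m, hm⟩

theorem ex_value_le_iSup (hl : 0 ≤ lam) (hG0 : ∀ x, 0 ≤ G x) (hG1 : ∀ x, G x ≤ 1) (k : ℕ)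
    (x : List M) (C : Finset (Fin n)) :
    (ex (P.next x) fun m => value P lam G k (m :: x) C) ≤
      ⨆ m : (P.next x).support, value P lam G k (m :: x) C :=
  ex_le_const _ (fun _ => abs_value_le P hl hG0 hG1 k _ C)
    fun _ hm => value_le_iSup P hl hG0 hG1 k x C hm

theorem value_succ_of_mem {k : ℕ} {x : List M} {C : Finset (Fin n)} (h : P.party x ∈ C) :
    value P lam G (k + 1) x C = ⨆ m : (P.next x).support, value P lam G k (m :: x) C := by
  rw [value, if_pos h]

theorem value_succ_of_notMem {k : ℕ} {x : List M} {C : Finset (Fin n)} (h : P.party x ∉ C) :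
    value P lam G (k + 1) x C = max (ex (P.next x) fun m => value P lam G k (m :: x) C)
      (⨆ m : (P.next x).support, value P lam G k (m :: x) (insert (P.party x) C)) := by
  rw [value, if_neg h]

/-- A corrupted party is worth at least its price. -/
theorem value_le_value_insert (hl : 0 ≤ lam) (hG0 : ∀ x, 0 ≤ G x) (hG1 : ∀ x, G x ≤ 1)
    (i : Fin n) (k : ℕ) :
    ∀ x C, value P lam G k x C ≤ value P lam G k x (insert i C) + lam := by
  induction k with
  | zero =>
    intro x C
    have : ((insert i C).card : ℝ) ≤ C.card + 1 := by exact_mod_cast Finset.card_insert_le i C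
    simp only [value]
    nlinarith
  | succ k ih =>
    intro x C
    have := nonempty_support (P.next x)
    have hsup : ∀ C, (⨆ m : (P.next x).support, value P lam G k (m :: x) C) ≤
        (⨆ m : (P.next x).support, value P lam G k (m :: x) (insert i C)) + lam := fun C =>
      ciSup_le fun m => (ih _ _).trans
        (add_le_add_left (value_le_iSup P hl hG0 hG1 k x _ m.2) lam)
    by_cases h : P.party x ∈ C
    · rw [value_succ_of_mem P h, value_succ_of_mem P (Finset.mem_insert_of_mem h)]
      exact hsup C
    by_cases hi : P.party x = i
    · subst hi
      rw [value_succ_of_notMem P h, value_succ_of_mem P (Finset.mem_insert_self _ _)]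
      refine max_le ((ex_value_le_iSup P hl hG0 hG1 k x C).trans (hsup C)) ?_
      linarith
    · have h' : P.party x ∉ insert i C := by
        rw [Finset.mem_insert, not_or]
        exact ⟨hi, h⟩
      rw [value_succ_of_notMem P h, value_succ_of_notMem P h', Finset.insert_comm]
      refine max_le ?_ ((hsup _).trans (add_le_add_left (le_max_right _ _) lam))
      refine le_trans ?_ (add_le_add_left (le_max_left _ _) lam)
      have hadd := ex_add (P.next x) (g := fun _ => lam)
        (fun m => abs_value_le P hl hG0 hG1 k (m :: x) (insert i C)) (fun _ => le_rfl)
      rw [ex_const] at hadd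
      rw [← hadd]
      have hb : ∀ m, |value P lam G k (m :: x) (insert i C) + lam| ≤ 1 + lam * n + lam := fun m =>
        (abs_add_le _ _).trans (add_le_add (abs_value_le P hl hG0 hG1 k _ _) (abs_of_nonneg hl).le)
      exact ex_mono _ (fun m => abs_value_le P hl hG0 hG1 k _ _) hb fun m _ => ih _ _

theorem value_empty_nonneg (hG0 : ∀ x, 0 ≤ G x) (k : ℕ) :
    ∀ x, 0 ≤ value P lam G k x ∅ := by
  induction k with
  | zero => intro x; simpa [value] using hG0 x
  | succ k ih =>
    intro x
    rw [value_succ_of_notMem P (Finset.notMem_empty _)]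
    exact (ex_nonneg _ fun _ => ih _).trans (le_max_left _ _)

theorem value_empty_le_one (hl : 0 ≤ lam) (hG0 : ∀ x, 0 ≤ G x) (hG1 : ∀ x, G x ≤ 1) (k : ℕ)
    (x : List M) : value P lam G k x ∅ ≤ 1 := by
  simpa using (value_bounds P hl hG0 hG1 k x ∅).2

end Value

/-! Averages over independent random sets. -/

section RandomSet

variable {ι : Type*} [DecidableEq ι]

/-- The expectation of `f` on the random subset of `s` that omits each `j` independently with
probability `u j`. -/
def mix (s : Finset ι) (u : ι → ℝ) (f : Finset ι → ℝ) : ℝ :=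
  ∑ C ∈ s.powerset, (∏ j ∈ C, (1 - u j)) * (∏ j ∈ s \ C, u j) * f C

theorem mix_empty (u : ι → ℝ) (f : Finset ι → ℝ) : mix ∅ u f = f ∅ := by
  simp [mix]

/-- Conditioning on the membership of `i` isolates the current speaker from the other parties. -/
theorem mix_insert {s : Finset ι} {i : ι} (hi : i ∉ s) (u : ι → ℝ) (f : Finset ι → ℝ) :
    mix (insert i s) u f = mix s u fun C => u i * f C + (1 - u i) * f (insert i C) := by
  rw [mix, mix, Finset.sum_powerset_insert hi, ← Finset.sum_add_distrib]
  refine Finset.sum_congr rfl fun C hC => ?_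
  have hiC : i ∉ C := fun h => hi (Finset.mem_powerset.1 hC h)
  rw [Finset.prod_insert hiC, Finset.insert_sdiff_of_notMem _ hiC,
    Finset.prod_insert (fun h => hi (Finset.mem_sdiff.1 h).1),
    Finset.insert_sdiff_insert, Finset.sdiff_insert_of_notMem hi]
  ring

theorem mix_congr {s : Finset ι} {u u' : ι → ℝ} {f f' : Finset ι → ℝ} (hu : ∀ j ∈ s, u j = u' j)
    (hf : ∀ C ⊆ s, f C = f' C) : mix s u f = mix s u' f' := by
  refine Finset.sum_congr rfl fun C hC => ?_
  have hC' := Finset.mem_powerset.1 hC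
  rw [hf C hC', Finset.prod_congr rfl fun j hj => by rw [hu j (hC' hj)],
    Finset.prod_congr rfl fun j hj => hu j (Finset.mem_sdiff.1 hj).1]

theorem mix_weight_nonneg {s C : Finset ι} {u : ι → ℝ} (hu : ∀ j, 0 ≤ u j ∧ u j ≤ 1) :
    0 ≤ (∏ j ∈ C, (1 - u j)) * ∏ j ∈ s \ C, u j :=
  mul_nonneg (Finset.prod_nonneg fun j _ => sub_nonneg.2 (hu j).2)
    (Finset.prod_nonneg fun j _ => (hu j).1)

theorem mix_mono {s : Finset ι} {u : ι → ℝ} {f f' : Finset ι → ℝ} (hu : ∀ j, 0 ≤ u j ∧ u j ≤ 1)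
    (hf : ∀ C ⊆ s, f C ≤ f' C) : mix s u f ≤ mix s u f' :=
  Finset.sum_le_sum fun C hC =>
    mul_le_mul_of_nonneg_left (hf C (Finset.mem_powerset.1 hC)) (mix_weight_nonneg hu)

theorem mix_one (s : Finset ι) (f : Finset ι → ℝ) : mix s (fun _ => 1) f = f ∅ := by
  induction s using Finset.induction_on generalizing f with
  | empty => exact mix_empty _ f
  | insert i s hi ih => rw [mix_insert hi, ih]; ring

theorem mix_sub_card (lam : ℝ) (s : Finset ι) (u : ι → ℝ) (a : ℝ) :
    mix s u (fun C => a - lam * C.card) = a - lam * ∑ j ∈ s, (1 - u j) := by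
  induction s using Finset.induction_on generalizing a with
  | empty => simp [mix_empty]
  | insert i s hi ih =>
    rw [mix_insert hi, Finset.sum_insert hi,
      mix_congr (u' := u) (f' := fun C => (a - lam * (1 - u i)) - lam * C.card) (fun _ _ => rfl), ih]
    · ring
    · intro C hC
      rw [Finset.card_insert_of_notMem fun h => hi (hC h)]
      push_cast
      ring

theorem ex_mix {α : Type*} (p : PMF α) (s : Finset ι) (u : ι → ℝ) (F : α → Finset ι → ℝ)
    {B : ℝ} (hF : ∀ a C, |F a C| ≤ B) :
    ex p (fun a => mix s u (F a)) = mix s u fun C => ex p fun a => F a C := by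
  unfold mix
  rw [ex_sum p _ (fun C a => (∏ j ∈ C, (1 - u j)) * (∏ j ∈ s \ C, u j) * F a C)
    (B := fun C => |(∏ j ∈ C, (1 - u j)) * ∏ j ∈ s \ C, u j| * B)]
  · exact Finset.sum_congr rfl fun C _ => ex_const_mul p _
  · intro C a
    rw [abs_mul]
    exact mul_le_mul_of_nonneg_left (hF a C) (abs_nonneg _)

end RandomSet

/-! ### From the priced game to an adversary with a hard corruption budget -/

section Policy

variable {n : ℕ} {M : Type} (P : Protocol n M)

/-- The corrupted parties of an adversary that decides, as a function of the transcript and of the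
corrupted parties, whether to corrupt the next speaker. -/
def corruptedBy (corr : List M → Finset (Fin n) → Prop)
    [∀ x C, Decidable (corr x C)] : List (Unit × M) → Finset (Fin n)
  | [] => ∅
  | _ :: v =>
    if corr (v.map Prod.snd) (corruptedBy corr v) then
      insert (P.party (v.map Prod.snd)) (corruptedBy corr v)
    else corruptedBy corr v

/-- The deterministic adversary whose decisions depend only on the transcript and on the corrupted
parties. -/
def policyAdversary (corr : List M → Finset (Fin n) → Prop) [∀ x C, Decidable (corr x C)]
    (send : List M → Finset (Fin n) → M) : Adversary P where
  Coin := Unit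
  toss _ := PMF.pure ()
  corrupt v _ := decide (corr (v.map Prod.snd) (corruptedBy P corr v))
  send v _ := send (v.map Prod.snd) (corruptedBy P corr v)

variable (corr : List M → Finset (Fin n) → Prop) [∀ x C, Decidable (corr x C)]
  (send : List M → Finset (Fin n) → M)

theorem corrupted_policyAdversary :
    (policyAdversary P corr send).corrupted = corruptedBy P corr := by
  refine funext fun v : List (Unit × M) => ?_
  induction v with
  | nil => rfl
  | cons a v ih =>
    have h : (policyAdversary P corr send).corrupted (a :: v) =
        if decide (corr (v.map Prod.snd) (corruptedBy P corr v)) = true then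
          insert (P.party (v.map Prod.snd)) ((policyAdversary P corr send).corrupted v)
        else (policyAdversary P corr send).corrupted v := rfl
    refine h.trans ?_
    rw [ih, corruptedBy]
    simp only [decide_eq_true_eq]

/-- The distribution of the next message under a policy. -/
def policyMessage (x : List M) (C : Finset (Fin n)) : PMF M :=
  if P.party x ∈ (if corr x C then insert (P.party x) C else C) then PMF.pure (send x C)
  else P.next x

/-- The distribution of the view after the given number of rounds under a policy. -/
def policyViews : ℕ → PMF (List (Unit × M))
  | 0 => PMF.pure []
  | j + 1 => (policyViews j).bind fun v =>
      (policyMessage P corr send (v.map Prod.snd) (corruptedBy P corr v)).map fun m => ((), m) :: v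

theorem message_policyAdversary (v : List (Unit × M)) :
    (policyAdversary P corr send).message v () =
      policyMessage P corr send (v.map Prod.snd) (corruptedBy P corr v) := by
  have h : (policyAdversary P corr send).message v () =
      if P.party (v.map Prod.snd) ∈
        (if decide (corr (v.map Prod.snd) (corruptedBy P corr v)) = true then
          insert (P.party (v.map Prod.snd)) ((policyAdversary P corr send).corrupted v)
        else (policyAdversary P corr send).corrupted v)
      then PMF.pure (send (v.map Prod.snd) (corruptedBy P corr v))
      else P.next (v.map Prod.snd) := rfl
  refine h.trans ?_
  rw [corrupted_policyAdversary, policyMessage]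
  simp only [decide_eq_true_eq]

theorem viewDist_policyAdversary (j : ℕ) :
    (policyAdversary P corr send).viewDist j = policyViews P corr send j := by
  induction j with
  | zero => rfl
  | succ j ih =>
    have h : (policyAdversary P corr send).viewDist (j + 1) =
        ((policyAdversary P corr send).viewDist j).bind fun v : List (Unit × M) =>
          (PMF.pure ()).bind fun r : Unit =>
            ((policyAdversary P corr send).message v r).map fun m => (r, m) :: v := rfl
    refine h.trans ?_
    rw [ih, policyViews]
    congr 1
    funext v
    rw [PMF.pure_bind, message_policyAdversary]

theorem length_of_mem_support_policyViews (j : ℕ) :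
    ∀ v ∈ (policyViews P corr send j).support, v.length = j := by
  induction j with
  | zero =>
    intro v hv
    rw [policyViews, PMF.support_pure, Set.mem_singleton_iff] at hv
    rw [hv]
    rfl
  | succ j ih =>
    intro v hv
    rw [policyViews, PMF.mem_support_bind_iff] at hv
    obtain ⟨w, hw, hv⟩ := hv
    rw [PMF.mem_support_map_iff] at hv
    obtain ⟨m, -, rfl⟩ := hv
    exact congrArg (· + 1) (ih w hw)

theorem isAdaptive_policyAdversary {t : ℝ} (ht : 0 ≤ t)
    (hcorr : ∀ x C, corr x C → (C.card : ℝ) + 1 ≤ t)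
    (hsend : ∀ x C, send x C ∈ (P.next x).support) :
    (policyAdversary P corr send).IsAdaptive t := by
  have hcard : ∀ v : List (Unit × M), ((corruptedBy P corr v).card : ℝ) ≤ t := by
    intro v
    induction v with
    | nil => simpa [corruptedBy] using ht
    | cons a v ih =>
      rw [corruptedBy]
      split_ifs with h
      · refine le_trans ?_ (hcorr _ _ h)
        exact_mod_cast Finset.card_insert_le _ _
      · exact ih
  refine ⟨fun v _ => ?_, fun _ _ v _ _ _ _ => hsend _ _⟩
  have h := congrFun (corrupted_policyAdversary P corr send) v
  exact (congrArg (fun D : Finset (Fin n) => (D.card : ℝ)) h).trans_le (hcard v)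

/-- A nonnegative quantity that does not decrease on average in any round of a policy. -/
theorem le_ex_policyViews {W : ℕ → List M → Finset (Fin n) → ℝ} (h0 : ∀ k x C, 0 ≤ W k x C)
    (h1 : ∀ k x C, W k x C ≤ 1)
    (hW : ∀ k x C, x.length + (k + 1) = P.rounds →
      W (k + 1) x C ≤ ex (policyMessage P corr send x C) fun m =>
        W k (m :: x) (if corr x C then insert (P.party x) C else C)) (j k : ℕ)
    (hjk : j + k = P.rounds) :
    W P.rounds [] ∅ ≤ ex (policyViews P corr send j) fun v => W k (v.map Prod.snd) (corruptedBy P corr v) := by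
  induction j generalizing k with
  | zero =>
    rw [policyViews, ex_pure, ← hjk, zero_add]
    exact le_rfl
  | succ j ih =>
    refine (ih (k + 1) (by omega)).trans ?_
    rw [policyViews, ex_bind _ _ (fun _ => h0 _ _ _) (fun _ => h1 _ _ _)]
    have hb : ∀ k x C, |W k x C| ≤ 1 := fun k x C => (abs_of_nonneg (h0 k x C)).trans_le (h1 k x C)
    refine ex_mono _ (B := 1) (D := 1) (fun _ => hb _ _ _) (fun v => ?_) fun v hv => ?_
    · rw [abs_of_nonneg (ex_nonneg _ fun _ => h0 _ _ _)]
      exact ex_le_const _ (fun _ => hb _ _ _) fun _ _ => h1 _ _ _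
    · rw [ex_map _ _ (fun _ => h0 _ _ _) (fun _ => h1 _ _ _)]
      have hlen := length_of_mem_support_policyViews P corr send j v hv
      exact hW k _ _ (by rw [List.length_map]; omega)

open Classical in
/-- The value of the penalised game is attained, up to an arbitrarily small loss, by an adversary
that respects a hard bound on the number of corruptions. -/
theorem exists_adversary_value_le {lam t ζ : ℝ} {G : List M → ℝ} (hl : 0 ≤ lam) (ht : 0 ≤ t)
    (hlt : 1 ≤ lam * t) (hζ : 0 < ζ) (hG0 : ∀ x, 0 ≤ G x) (hG1 : ∀ x, G x ≤ 1) :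
    ∃ A : Adversary P, A.IsAdaptive t ∧
      value P lam G P.rounds [] ∅ - ζ ≤
        ex (A.viewDist P.rounds) fun v => G (A.transcript v) := by
  -- Suprema over messages need not be attained, so each round may lose `z`; the `+ 1` covers a
  -- protocol with no rounds.
  set z : ℝ := ζ / (P.rounds + 1) with hz
  have hz0 : 0 < z := by positivity
  have hex : ∀ x : List M, ∀ C : Finset (Fin n), ∃ m ∈ (P.next x).support,
      (⨆ m : (P.next x).support, value P lam G (P.rounds - (x.length + 1)) (m :: x) C) - z ≤
        value P lam G (P.rounds - (x.length + 1)) (m :: x) C := by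
    intro x C
    have := nonempty_support (P.next x)
    obtain ⟨m, hm⟩ := exists_lt_of_lt_ciSup (sub_lt_self
      (⨆ m : (P.next x).support, value P lam G (P.rounds - (x.length + 1)) (m :: x) C) hz0)
    exact ⟨m, m.2, hm.le⟩
  choose s hs hsv using hex
  set send : List M → Finset (Fin n) → M := fun x C => s x (insert (P.party x) C) with hsend
  set corr : List M → Finset (Fin n) → Prop := fun x C => P.party x ∉ C ∧ (C.card : ℝ) + 1 ≤ t ∧
    (ex (P.next x) fun m => value P lam G (P.rounds - (x.length + 1)) (m :: x) C) <
      ⨆ m : (P.next x).support,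
        value P lam G (P.rounds - (x.length + 1)) (m :: x) (insert (P.party x) C) with hcorr
  -- Truncation at zero keeps the induction valid when the budget blocks a profitable corruption; `k
  -- * z` is the loss allowed in the remaining rounds.
  set W : ℕ → List M → Finset (Fin n) → ℝ := fun k x C => max 0 (value P lam G k x C - k * z)
    with hWdef
  have hW0 : ∀ k x C, 0 ≤ W k x C := fun k x C => le_max_left _ _
  have hW1 : ∀ k x C, W k x C ≤ 1 := fun k x C => by
    refine max_le zero_le_one ?_
    have h1 := (value_bounds P hl hG0 hG1 k x C).2
    have h2 : 0 ≤ lam * (C.card : ℝ) := by positivity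
    have h3 : 0 ≤ (k : ℝ) * z := by positivity
    linarith
  refine ⟨policyAdversary P corr send,
    isAdaptive_policyAdversary P corr send ht (fun x C h => h.2.1) fun x C => hs _ _, ?_⟩
  have hstep : ∀ k x C, x.length + (k + 1) = P.rounds →
      W (k + 1) x C ≤ ex (policyMessage P corr send x C) fun m =>
        W k (m :: x) (if corr x C then insert (P.party x) C else C) := by
    intro k x C hk
    have hk' : P.rounds - (x.length + 1) = k := by omega
    refine max_le (ex_nonneg _ fun _ => hW0 _ _ _) ?_
    have hsup := hsv x (insert (P.party x) C)
    rw [hk'] at hsup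
    have hmove : (⨆ m : (P.next x).support, value P lam G k (m :: x) (insert (P.party x) C)) -
        ((k + 1 : ℕ) : ℝ) * z ≤ W k (send x C :: x) (insert (P.party x) C) := by
      refine le_trans ?_ (le_max_right _ _)
      push_cast
      linarith
    have hhonest : (ex (P.next x) fun m => value P lam G k (m :: x) C) -
        ((k + 1 : ℕ) : ℝ) * z ≤ ex (P.next x) fun m => W k (m :: x) C := by
      have hadd := ex_add (P.next x) (g := fun _ => -(k * z))
        (fun m => abs_value_le P hl hG0 hG1 k (m :: x) C) (fun _ => le_rfl)
      rw [ex_const] at hadd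
      have hmono := ex_mono (P.next x) (f := fun m => value P lam G k (m :: x) C + -(k * z))
        (g := fun m => W k (m :: x) C) (D := 1)
        (fun m => (abs_add_le _ _).trans
          (add_le_add (abs_value_le P hl hG0 hG1 k (m :: x) C) le_rfl))
        (fun m => (abs_of_nonneg (hW0 _ _ _)).trans_le (hW1 _ _ _))
        (fun m _ => by rw [← sub_eq_add_neg]; exact le_max_right _ _)
      push_cast
      linarith
    by_cases hC : P.party x ∈ C
    · have hnot : ¬corr x C := fun h => h.1 hC
      rw [policyMessage, if_neg hnot, if_pos hC, ex_pure, value_succ_of_mem P hC]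
      rwa [Finset.insert_eq_of_mem hC] at hmove
    rw [value_succ_of_notMem P hC]
    by_cases h : corr x C
    · rw [policyMessage, if_pos h, if_pos (Finset.mem_insert_self _ _), ex_pure]
      have hlt := h.2.2
      rw [hk'] at hlt
      rwa [max_eq_right hlt.le]
    · rw [policyMessage, if_neg h, if_neg hC]
      rcases le_or_gt (⨆ m : (P.next x).support, value P lam G k (m :: x) (insert (P.party x) C))
        (ex (P.next x) fun m => value P lam G k (m :: x) C) with hle | hlt
      · rwa [max_eq_left hle]
      · rw [max_eq_right hlt.le]
        -- Corruption is strictly better yet not performed, so the budget is exhausted. One more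
        -- corruption then has value at most `1 - lam * t ≤ 0`, below the truncation level.
        have hcard : t < (C.card : ℝ) + 1 := by
          by_contra! hle
          exact h ⟨hC, hle, by rwa [hk']⟩
        have := nonempty_support (P.next x)
        have hneg : (⨆ m : (P.next x).support,
            value P lam G k (m :: x) (insert (P.party x) C)) ≤ 0 := by
          refine ciSup_le fun m => (value_bounds P hl hG0 hG1 k _ _).2.trans ?_
          rw [Finset.card_insert_of_notMem hC]
          push_cast
          nlinarith
        have hkz : 0 ≤ ((k + 1 : ℕ) : ℝ) * z := by positivity
        have hex0 := ex_nonneg (P.next x) fun m => hW0 k (m :: x) C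
        linarith
  have hmain := le_ex_policyViews P corr send hW0 hW1 hstep P.rounds 0 (add_zero _)
  have hfin : (ex (policyViews P corr send P.rounds) fun v =>
      W 0 (v.map Prod.snd) (corruptedBy P corr v)) ≤
      ex (policyViews P corr send P.rounds) fun v => G (v.map Prod.snd) := by
    refine ex_mono _ (B := 1) (D := 1)
      (fun v => (abs_of_nonneg (hW0 _ _ _)).trans_le (hW1 _ _ _))
      (fun v => (abs_of_nonneg (hG0 _)).trans_le (hG1 _)) fun v _ => max_le (hG0 _) ?_
    have h2 : 0 ≤ lam * ((corruptedBy P corr v).card : ℝ) := by positivity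
    simp only [value, Nat.cast_zero, zero_mul, sub_zero]
    linarith
  have hζz : (P.rounds : ℝ) * z ≤ ζ := by
    rw [hz, mul_div_assoc', div_le_iff₀ (by positivity)]
    nlinarith
  have hle := (le_max_right (0 : ℝ) _).trans (hmain.trans hfin)
  have hview : (ex ((policyAdversary P corr send).viewDist P.rounds) fun v =>
      G ((policyAdversary P corr send).transcript v)) =
      ex (policyViews P corr send P.rounds) fun v => G (v.map Prod.snd) :=
    congrArg (fun q : PMF (List (Unit × M)) => ex q fun v => G (v.map Prod.snd))
      (viewDist_policyAdversary P corr send P.rounds)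
  rw [hview]
  linarith

end Policy

/-! ### The potential and its one-step inequalities -/

section Potential

/-- The squared excess of the probability `1 - u` of being corrupted over `β`. -/
def excess (β u : ℝ) : ℝ := max 0 (1 - u - β) ^ 2

theorem one_add_two_mul_mul_exp_neg_le {z : ℝ} (hz : -1 ≤ z) :
    (1 + 2 * z) * Real.exp (-z) ≤ 1 + z := by
  rw [Real.exp_neg, ← div_eq_mul_inv, div_le_iff₀ (Real.exp_pos z)]
  nlinarith [mul_le_mul_of_nonneg_left (Real.add_one_le_exp z) (by linarith : 0 ≤ 1 + z), sq_nonneg z]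

/-- With `z = η * y / 2`, this is `(1 + 2 * z) * exp(-z) ≤ 1 + z`. The rate `η / 2`, half the tilt,
leaves room for the second-order term. -/
theorem tilt_mul_exp_le {η lam v v' y : ℝ} (hη : 0 ≤ η) (hβ : η * lam ≤ 1 / 2) (hy : -lam ≤ y)
    (hv : v + y ≤ v') :
    (1 + η * y) * Real.exp (-(η / 2) * v') ≤
      Real.exp (-(η / 2) * v) * (1 + η / 2 * y) := by
  have hηy : -(η * lam) ≤ η * y := by nlinarith
  calc (1 + η * y) * Real.exp (-(η / 2) * v')
      ≤ (1 + η * y) * Real.exp (-(η / 2) * v + -(η / 2 * y)) := by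
        refine mul_le_mul_of_nonneg_left (Real.exp_le_exp.2 ?_) (by linarith)
        nlinarith
    _ = Real.exp (-(η / 2) * v) * ((1 + 2 * (η / 2 * y)) * Real.exp (-(η / 2 * y))) := by
        rw [Real.exp_add]
        ring
    _ ≤ _ := mul_le_mul_of_nonneg_left (one_add_two_mul_mul_exp_neg_le (by linarith))
        (Real.exp_pos _).le

/-- Lowering the honest probability to the cap `1 - β` creates no excess, so the mandatory
corruption is free in the potential. -/
theorem excess_min (β u : ℝ) : excess β u = (1 - min u (1 - β) - β) ^ 2 := by
  rw [excess]
  rcases le_total u (1 - β) with h | h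
  · rw [min_eq_left h, max_eq_right (by linarith)]
  · rw [min_eq_right h, max_eq_left (by linarith)]
    ring

/-- The tilt factor cancels the denominator of the Bayes posterior. Expanding the square leaves a
term linear in `y`, which averages out, and a quadratic remainder, where `1 + η * y ≥ 1/2` gives the
factor 2. -/
theorem tilt_mul_excess_le {η lam u y : ℝ} (hη : 0 ≤ η) (hβ : η * lam ≤ 1 / 2) (hy : -lam ≤ y)
    (hu : 0 ≤ u) (hu1 : u ≤ 1) :
    (1 + η * y) * excess (η * lam) (min u (1 - η * lam) / (1 + η * y)) ≤
      (1 + η * y) * excess (η * lam) u +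
        2 * (1 - min u (1 - η * lam) - η * lam) * min u (1 - η * lam) * (η * y) +
        2 * (η * y) ^ 2 := by
  have hηy : -(η * lam) ≤ η * y := by nlinarith
  rw [excess_min _ u]
  have hu0 : 0 ≤ min u (1 - η * lam) := le_min hu (by linarith)
  have hu01 : min u (1 - η * lam) ≤ 1 := (min_le_left _ _).trans hu1
  generalize min u (1 - η * lam) = w at *
  generalize η * lam = β at *
  generalize η * y = r at *
  have hg : 1 / 2 ≤ 1 + r := by linarith
  have hsq : excess β (w / (1 + r)) ≤ (1 - w / (1 + r) - β) ^ 2 := by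
    rw [excess]
    rcases le_total 0 (1 - w / (1 + r) - β) with h | h
    · rw [max_eq_right h]
    · rw [max_eq_left h]
      nlinarith [sq_nonneg (1 - w / (1 + r) - β)]
  refine (mul_le_mul_of_nonneg_left hsq (by linarith)).trans ?_
  have hkey : (1 + r) * (1 - w / (1 + r) - β) ^ 2 =
      (1 + r) * (1 - w - β) ^ 2 + 2 * (1 - w - β) * w * r + w ^ 2 * r ^ 2 / (1 + r) := by
    field_simp
    ring
  rw [hkey]
  have hlast : w ^ 2 * r ^ 2 / (1 + r) ≤ 2 * r ^ 2 := by
    rw [div_le_iff₀ (by linarith)]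
    have hw2 : w ^ 2 ≤ 1 := by nlinarith
    nlinarith [sq_nonneg r, mul_le_mul_of_nonneg_right hw2 (sq_nonneg r),
      mul_le_mul_of_nonneg_left hg (sq_nonneg r)]
  linarith

/-- The potential of a state of the upward attack: `v` is the value of the downward game and `u j`
is the conditional probability that party `j` is not corrupted. -/
def potential {ι : Type*} [Fintype ι] (η lam γ v : ℝ) (u : ι → ℝ) : ℝ :=
  Real.exp (-(η / 2) * v) + lam * η / (2 * γ) * (1 - v) +
    lam * ∑ j, (η * lam + γ + excess (η * lam) (u j) / (4 * γ))

/-- Along the tilt `1 + η * y` of a step with mean zero the potential does not increase on average: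
it increases by at most a multiple of `y`. -/
theorem exists_tilt_mul_potential_le {ι : Type*} [Fintype ι] [DecidableEq ι] {η lam γ v : ℝ}
    (hη : 0 ≤ η) (hl : 0 ≤ lam) (hβ : η * lam ≤ 1 / 2) (hγ : 0 < γ) {u : ι → ℝ} {i : ι}
    (hu : 0 ≤ u i) (hu1 : u i ≤ 1) :
    ∃ κ : ℝ, ∀ y v' : ℝ, -lam ≤ y → v + y ≤ v' →
      (1 + η * y) * potential η lam γ v'
        (Function.update u i (min (u i) (1 - η * lam) / (1 + η * y))) ≤
      potential η lam γ v u + κ * y := by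
  set S : ℝ := ∑ j ∈ Finset.univ.erase i, (η * lam + γ + excess (η * lam) (u j) / (4 * γ)) with hS
  set w := min (u i) (1 - η * lam) with hw
  -- `κ` collects the coefficients of `y`. The term `-lam * η ^ 2 / (2 * γ) * y ^ 2` produced by `1
  -- - v` cancels the quadratic error of the excess; this fixes the weight of `1 - v` in the
  -- potential.
  refine ⟨Real.exp (-(η / 2) * v) * (η / 2) + lam * η / (2 * γ) * (η * (1 - v) - 1) +
    lam * (S + (η * lam + γ)) * η + lam / (4 * γ) * (η * excess (η * lam) (u i) +
      2 * (1 - w - η * lam) * w * η), fun y v' hy hv => ?_⟩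
  have h1 := tilt_mul_exp_le hη hβ hy hv
  have h2 := tilt_mul_excess_le hη hβ hy hu hu1
  rw [← hw] at h2
  have hsum : ∀ u' : ι → ℝ, ∑ j, (η * lam + γ + excess (η * lam) (u' j) / (4 * γ)) =
      ∑ j ∈ Finset.univ.erase i, (η * lam + γ + excess (η * lam) (u' j) / (4 * γ)) +
        (η * lam + γ + excess (η * lam) (u' i) / (4 * γ)) := fun u' =>
    (Finset.sum_erase_add _ _ (Finset.mem_univ i)).symm
  have hS' : ∑ j ∈ Finset.univ.erase i, (η * lam + γ +
      excess (η * lam) (Function.update u i (w / (1 + η * y)) j) / (4 * γ)) = S :=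
    Finset.sum_congr rfl fun j hj => by
      rw [Function.update_of_ne (Finset.ne_of_mem_erase hj)]
  rw [potential, potential, hsum, hsum u, hS', ← hS, Function.update_self]
  have hg : 0 ≤ 1 + η * y := by nlinarith
  have h3 : (1 + η * y) * (1 - v') ≤ (1 + η * y) * (1 - v - y) :=
    mul_le_mul_of_nonneg_left (by linarith) hg
  have hc : 0 ≤ lam / (4 * γ) := by positivity
  have h4 := mul_le_mul_of_nonneg_left h2 hc
  have h5 := mul_le_mul_of_nonneg_left h3 (show 0 ≤ 2 * η * (lam / (4 * γ)) by positivity)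
  have e1 : ∀ q : ℝ, q / (4 * γ) * lam = lam / (4 * γ) * q := fun q => by ring
  have e2 : lam * η / (2 * γ) = 2 * η * (lam / (4 * γ)) := by field_simp; ring
  rw [e2]
  generalize excess (η * lam) (w / (1 + η * y)) = φ' at *
  generalize excess (η * lam) (u i) = φ at *
  have e3 := e1 φ
  have e4 := e1 φ'
  generalize φ / (4 * γ) = ψ at *
  generalize φ' / (4 * γ) = ψ' at *
  generalize lam / (4 * γ) = c at *
  have e5 : (1 + η * y) * (ψ' * lam) = (1 + η * y) * (c * φ') := by rw [e4]
  linear_combination h1 + h4 + h5 + e5 - e3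

/-- AM-GM, `s ≤ γ + s ^ 2 / (4 * γ)`, bounds the corruption probability by the quadratic quantity
that the potential can track. -/
theorem one_sub_le_excess {β γ u : ℝ} (hγ : 0 < γ) :
    1 - u ≤ β + γ + excess β u / (4 * γ) := by
  have h1 : 1 - u - β ≤ max 0 (1 - u - β) := le_max_right _ _
  have h2 : max 0 (1 - u - β) ≤ γ + excess β u / (4 * γ) := by
    rw [excess, ← sub_nonneg]
    have : γ + max 0 (1 - u - β) ^ 2 / (4 * γ) - max 0 (1 - u - β) =
        (max 0 (1 - u - β) - 2 * γ) ^ 2 / (4 * γ) := by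
      field_simp
      ring
    rw [this]
    positivity
  linarith

end Potential

theorem abs_mix_le {ι : Type*} [DecidableEq ι] (s : Finset ι) (u : ι → ℝ) {f : Finset ι → ℝ}
    {B : ℝ} (hf : ∀ C, |f C| ≤ B) :
    |mix s u f| ≤ ∑ C ∈ s.powerset, |(∏ j ∈ C, (1 - u j)) * ∏ j ∈ s \ C, u j| * B := by
  refine (Finset.abs_sum_le_sum_abs _ _).trans (Finset.sum_le_sum fun C _ => ?_)
  rw [abs_mul]
  exact mul_le_mul_of_nonneg_left (hf C) (abs_nonneg _)

theorem mix_const_mul {ι : Type*} [DecidableEq ι] (s : Finset ι) (u : ι → ℝ) (c : ℝ)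
    (f : Finset ι → ℝ) : mix s u (fun C => c * f C) = c * mix s u f := by
  rw [mix, mix, Finset.mul_sum]
  exact Finset.sum_congr rfl fun C _ => by ring

/-! ### The upward attack by tilting -/

section Attack

variable {n : ℕ} {M : Type} (P : Protocol n M) {lam : ℝ} {G : List M → ℝ}

/-- One round of the upward attack: the speaker, who is honest with probability `u`, sends a message
whose density with respect to the honest distribution is `g`. -/
theorem ex_tilt_le_value (hl : 0 ≤ lam) (hG0 : ∀ x, 0 ≤ G x) (hG1 : ∀ x, G x ≤ 1) {k : ℕ}
    {x : List M} {C : Finset (Fin n)} (hC : P.party x ∉ C) {u w B : ℝ} {g : M → ℝ}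
    (hw0 : 0 ≤ w) (hwu : w ≤ u) (hwg : ∀ m, w ≤ g m) (hgB : ∀ m, |g m| ≤ B)
    (hg : ex (P.next x) g = 1) :
    (ex (P.next x) fun m => w * value P lam G k (m :: x) C +
        (g m - w) * value P lam G k (m :: x) (insert (P.party x) C)) ≤
      u * value P lam G (k + 1) x C +
        (1 - u) * value P lam G (k + 1) x (insert (P.party x) C) := by
  set D := insert (P.party x) C with hD
  set S := ⨆ m : (P.next x).support, value P lam G k (m :: x) D with hS
  have hb := fun C m => abs_value_le P hl hG0 hG1 k (m :: x) C
  rw [value_succ_of_notMem P hC, value_succ_of_mem P (Finset.mem_insert_self (P.party x) C),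
    ← hD, ← hS]
  have hA0 : 0 ≤ 1 + lam * (n : ℝ) := by positivity
  have hB0 : ∀ m, |w * value P lam G k (m :: x) C| ≤ w * (1 + lam * n) := fun m => by
    rw [abs_mul, abs_of_nonneg hw0]
    exact mul_le_mul_of_nonneg_left (hb _ _) hw0
  have hgw : ∀ m, |g m - w| ≤ B + w := fun m =>
    (abs_sub _ _).trans (add_le_add (hgB m) (abs_of_nonneg hw0).le)
  have hB1 : ∀ m, |(g m - w) * value P lam G k (m :: x) D| ≤ (B + w) * (1 + lam * n) := fun m => by
    rw [abs_mul]
    exact mul_le_mul (hgw m) (hb _ _) (abs_nonneg _) ((abs_nonneg _).trans (hgw m))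
  have hB2 : ∀ m, |(g m - w) * S| ≤ (B + w) * |S| := fun m => by
    rw [abs_mul]
    exact mul_le_mul_of_nonneg_right (hgw m) (abs_nonneg _)
  rw [ex_add _ hB0 hB1, ex_const_mul]
  have h1 : (ex (P.next x) fun m => (g m - w) * value P lam G k (m :: x) D) ≤ (1 - w) * S := by
    calc _ ≤ ex (P.next x) fun m => (g m - w) * S :=
          ex_mono _ hB1 hB2 fun m hm => mul_le_mul_of_nonneg_left
            (value_le_iSup P hl hG0 hG1 k x D hm) (sub_nonneg.2 (hwg m))
      _ = (1 - w) * S := by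
          have h2 := ex_add (P.next x) (g := fun _ => -w) hgB fun _ => le_rfl
          rw [ex_const, hg] at h2
          have h3 := ex_const_mul (P.next x) S (f := fun m => g m + -w)
          rw [h2] at h3
          rw [sub_eq_add_neg, mul_comm, ← h3]
          exact ex_congr _ fun m _ => by ring
  have h4 := le_max_left (ex (P.next x) fun m => value P lam G k (m :: x) C) S
  have h5 := le_max_right (ex (P.next x) fun m => value P lam G k (m :: x) C) S
  -- The mass `u - w` is corrupted in this round: it moves from the optimal value at `C` to `S`.
  have h6 : 0 ≤ (u - w) * (max (ex (P.next x) fun m => value P lam G k (m :: x) C) S - S) :=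
    mul_nonneg (by linarith) (by linarith)
  nlinarith [mul_le_mul_of_nonneg_left h4 hw0]

/-- If the downward adversary cannot push the output down then the upward adversary can push it
up: here party `j` is honest with probability `u j`, independently of the other parties. -/
theorem one_sub_potential_le_mix {η γ : ℝ} (hl : 0 < lam) (hη : 0 ≤ η) (hβ : η * lam ≤ 1 / 2)
    (hγ : 0 < γ) (hG : ∀ x, G x = 0 ∨ G x = 1) (k : ℕ) :
    ∀ (x : List M) (u : Fin n → ℝ), (∀ j, 0 ≤ u j ∧ u j ≤ 1) →
      1 - potential η lam γ (1 - value P lam (fun x => 1 - G x) k x ∅) u ≤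
        mix Finset.univ u (value P lam G k x) := by
  have hG0 : ∀ x, 0 ≤ G x := fun x => by rcases hG x with h | h <;> rw [h]; exact zero_le_one
  have hG1 : ∀ x, G x ≤ 1 := fun x => by rcases hG x with h | h <;> rw [h]; exact zero_le_one
  have hH0 : ∀ x, 0 ≤ 1 - G x := fun x => sub_nonneg.2 (hG1 x)
  have hH1 : ∀ x, 1 - G x ≤ 1 := fun x => by linarith [hG0 x]
  set V : ℕ → List M → ℝ := fun k x => 1 - value P lam (fun x => 1 - G x) k x ∅ with hV
  have hV0 : ∀ k x, 0 ≤ V k x := fun k x =>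
    sub_nonneg.2 (value_empty_le_one P hl.le hH0 hH1 k x)
  have hV1 : ∀ k x, V k x ≤ 1 := fun k x =>
    sub_le_self _ (value_empty_nonneg P hH0 k x)
  induction k with
  | zero =>
    intro x u hu
    have hval : V 0 x = G x := by simp [hV, value]
    change 1 - potential η lam γ (V 0 x) u ≤ mix Finset.univ u (fun C => G x - lam * C.card)
    rw [mix_sub_card, hval, potential]
    have hsum : lam * ∑ j, (1 - u j) ≤
        lam * ∑ j, (η * lam + γ + excess (η * lam) (u j) / (4 * γ)) :=
      mul_le_mul_of_nonneg_left (Finset.sum_le_sum fun j _ => one_sub_le_excess hγ) hl.le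
    have hmu : 0 ≤ lam * η / (2 * γ) * (1 - G x) := mul_nonneg (by positivity) (hH0 x)
    -- This uses that the output is binary: the exponential is 1 at output 0 and nonnegative at
    -- output 1.
    have hexp : 1 - G x ≤ Real.exp (-(η / 2) * G x) := by
      rcases hG x with h | h
      · simp [h]
      · rw [h, sub_self]
        positivity
    linarith
  | succ k ih =>
    intro x u hu
    change 1 - potential η lam γ (V (k + 1) x) u ≤ _
    set i := P.party x with hi
    set p := P.next x with hp
    set v := V (k + 1) x with hv
    classical
    set X : M → ℝ := fun m => if m ∈ p.support then V k (m :: x) - v else 0 with hX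
    have hXs : ∀ m ∈ p.support, X m = V k (m :: x) - v := fun m hm => if_pos hm
    have hXn : ∀ m ∉ p.support, X m = 0 := fun m hm => if_neg hm
    have hXabs : ∀ m, |X m| ≤ 1 := fun m => by
      by_cases hm : m ∈ p.support
      · rw [hXs m hm, abs_le]
        constructor <;> linarith [hV0 k (m :: x), hV1 k (m :: x), hV0 (k + 1) x, hV1 (k + 1) x]
      · rw [hXn m hm, abs_zero]
        exact zero_le_one
    have hvalue := value_succ_of_notMem P (lam := lam) (G := fun x => 1 - G x) (k := k) (x := x)
      (Finset.notMem_empty _)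
    -- The downward player could corrupt the speaker and force `m`; the corruption costs at most
    -- `lam`.
    have hXlam : ∀ m, -lam ≤ X m := fun m => by
      by_cases hm : m ∈ p.support
      · rw [hXs m hm]
        have h1 := value_le_iSup P hl.le hH0 hH1 k x (insert (P.party x) ∅) hm
        have h2 := value_le_value_insert P hl.le hH0 hH1 (P.party x) k (m :: x) ∅
        have h3 := (h1.trans (le_max_right _ _)).trans hvalue.ge
        simp only [hV, hv]
        linarith
      · rw [hXn m hm]
        linarith
    set δ := ex p X with hδ
    -- Leaving the speaker honest is also open to the downward player.
    have hδ0 : 0 ≤ δ := by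
      have h1 := (le_max_left _ _).trans hvalue.ge
      have h2 := ex_add p (f := X) (g := fun m => value P lam (fun x => 1 - G x) k (m :: x) ∅)
        hXabs fun m => abs_value_le P hl.le hH0 hH1 k _ _
      rw [ex_congr p (g := fun _ => 1 - v) fun m hm => by rw [hXs m hm]; simp only [hV]; ring,
        ex_const] at h2
      have h3 : 1 - v = value P lam (fun x => 1 - G x) (k + 1) x ∅ := by simp [hv, hV]
      linarith
    have hδ1 : δ ≤ 1 := ex_le_const p hXabs fun m _ => (le_abs_self _).trans (hXabs m)
    -- Recentring by `δ` would break the floor `-lam`; the scaling `c` restores it. Since `c * (lam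
    -- + δ) = lam`, one has `X - Y = (1 - c) * (X + lam) ≥ 0`.
    set c := lam / (lam + δ) with hc
    have hc0 : 0 ≤ c := by positivity
    have hc1 : c ≤ 1 := div_le_one_of_le₀ (by linarith) (by linarith)
    have hcδ : c * (lam + δ) = lam := div_mul_cancel₀ _ (by positivity)
    set Y : M → ℝ := fun m => c * (X m - δ) with hY
    have hYlam : ∀ m, -lam ≤ Y m := fun m => by
      have := mul_nonneg hc0 (show 0 ≤ X m + lam by linarith [hXlam m])
      simp only [hY]
      linarith
    have hYX : ∀ m, Y m ≤ X m := fun m => by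
      have := mul_nonneg (sub_nonneg.2 hc1) (show 0 ≤ X m + lam by linarith [hXlam m])
      simp only [hY]
      linarith
    have hYabs : ∀ m, |Y m| ≤ 2 := fun m => by
      have h1 : |X m - δ| ≤ 2 := (abs_sub _ _).trans (by
        rw [abs_of_nonneg hδ0]; linarith [hXabs m])
      rw [hY, abs_mul, abs_of_nonneg hc0]
      nlinarith [abs_nonneg (X m - δ)]
    have hYaffine : ∀ a b : ℝ, ex p (fun m => a + b * Y m) = a := fun a b => by
      have h1 := ex_add p (f := X) (g := fun _ => -δ) hXabs fun _ => le_rfl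
      rw [ex_const, ← hδ, add_neg_cancel] at h1
      have h2 := ex_add p (f := fun _ => a) (g := fun m => (b * c) * (X m + -δ))
        (D := |b * c| * 2) (fun _ => le_rfl) fun m => by
          rw [abs_mul]
          refine mul_le_mul_of_nonneg_left ?_ (abs_nonneg _)
          refine (abs_add_le _ _).trans ?_
          rw [abs_neg, abs_of_nonneg hδ0]
          linarith [hXabs m]
      rw [ex_const, ex_const_mul, h1, mul_zero, add_zero] at h2
      exact (ex_congr p fun m _ => by simp only [hY]; ring).trans h2
    -- The honest mass kept in this round: no more than is still honest, and no more than the least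
    -- possible value of the tilted density.
    set w := min (u i) (1 - η * lam) with hw
    have hw0 : 0 ≤ w := le_min (hu i).1 (by linarith)
    have hwg : ∀ m, w ≤ 1 + η * Y m := fun m =>
      (min_le_right _ _).trans (by nlinarith [hYlam m])
    have hg0 : ∀ m, 0 < 1 + η * Y m := fun m => by nlinarith [hYlam m]
    have hgabs : ∀ m, |1 + η * Y m| ≤ 1 + η * 2 := fun m => by
      rw [abs_of_pos (hg0 m)]
      have := mul_le_mul_of_nonneg_left ((le_abs_self _).trans (hYabs m)) hη
      linarith
    obtain ⟨κ, hκ⟩ := exists_tilt_mul_potential_le (v := v) hη hl.le hβ hγ (hu i).1 (hu i).2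
    have huniv : (Finset.univ : Finset (Fin n)) = insert i (Finset.univ.erase i) :=
      (Finset.insert_erase (Finset.mem_univ i)).symm
    have hFabs : ∀ m C, |w * value P lam G k (m :: x) C +
        (1 + η * Y m - w) * value P lam G k (m :: x) (insert i C)| ≤
        w * (1 + lam * n) + (1 + η * 2 + w) * (1 + lam * n) := fun m C => by
      refine (abs_add_le _ _).trans (add_le_add ?_ ?_)
      · rw [abs_mul, abs_of_nonneg hw0]
        exact mul_le_mul_of_nonneg_left (abs_value_le P hl.le hG0 hG1 k _ _) hw0
      · rw [abs_mul]
        exact mul_le_mul ((abs_sub _ _).trans (add_le_add (hgabs m) (abs_of_nonneg hw0).le))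
          (abs_value_le P hl.le hG0 hG1 k _ _) (abs_nonneg _) (by positivity)
    -- As `Y` has mean zero, `(η - κ) * Y m` can be added freely: `η` comes from the tilted constant
    -- 1, `κ` from the potential.
    calc 1 - potential η lam γ v u
        = ex p fun m => 1 - potential η lam γ v u + (η - κ) * Y m := (hYaffine _ _).symm
      _ ≤ ex p fun m => mix (Finset.univ.erase i) u fun C => w * value P lam G k (m :: x) C +
            (1 + η * Y m - w) * value P lam G k (m :: x) (insert i C) := by
          refine ex_mono p (B := |1 - potential η lam γ v u| + |η - κ| * 2) (fun m => ?_)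
            (fun m => abs_mix_le _ _ (hFabs m)) fun m hm => ?_
          · refine (abs_add_le _ _).trans (add_le_add le_rfl ?_)
            rw [abs_mul]
            exact mul_le_mul_of_nonneg_left (hYabs m) (abs_nonneg _)
          -- Bayes' rule: given `m`, the speaker is honest with probability `w / (1 + η * Y m)`.
          · set u' := Function.update u i (w / (1 + η * Y m)) with hu'
            have hu'01 : ∀ j, 0 ≤ u' j ∧ u' j ≤ 1 := fun j => by
              rcases eq_or_ne j i with rfl | hj
              · rw [hu', Function.update_self]
                exact ⟨div_nonneg hw0 (hg0 m).le, div_le_one_of_le₀ (hwg m) (hg0 m).le⟩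
              · rw [hu', Function.update_of_ne hj]
                exact hu j
            have h1 := hκ (Y m) (V k (m :: x)) (hYlam m) (by linarith [hYX m, hXs m hm])
            have h2 := mul_le_mul_of_nonneg_left (ih (m :: x) u' hu'01) (hg0 m).le
            have h3 : (mix (Finset.univ.erase i) u fun C => w * value P lam G k (m :: x) C +
                (1 + η * Y m - w) * value P lam G k (m :: x) (insert i C)) =
                (1 + η * Y m) * mix Finset.univ u' (value P lam G k (m :: x)) := by
              rw [huniv, mix_insert (Finset.notMem_erase i _), ← mix_const_mul]
              rw [← huniv]
              refine mix_congr (fun j hj => ?_) fun C _ => ?_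
              · rw [hu', Function.update_of_ne (Finset.ne_of_mem_erase hj)]
              · rw [hu', Function.update_self]
                have := (hg0 m).ne'
                field_simp
            rw [h3]
            linarith
      _ = mix (Finset.univ.erase i) u fun C => ex p fun m => w * value P lam G k (m :: x) C +
            (1 + η * Y m - w) * value P lam G k (m :: x) (insert i C) := ex_mix p _ _ _ hFabs
      _ ≤ mix (Finset.univ.erase i) u fun C => u i * value P lam G (k + 1) x C +
            (1 - u i) * value P lam G (k + 1) x (insert i C) :=
          mix_mono hu fun C hC => ex_tilt_le_value P hl.le hG0 hG1
            (fun h => Finset.notMem_erase i _ (hC h)) hw0 (min_le_left _ _) hwg hgabs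
            (hYaffine 1 η)
      _ = mix Finset.univ u (value P lam G (k + 1) x) := by
          conv_rhs => rw [huniv, mix_insert (Finset.notMem_erase i _)]

end Attack

/-! ### Choosing between the two attacks -/

section Dichotomy

variable {n : ℕ} {M : Type} (P : Protocol n M)

theorem expectedOutcome_eq_ex (A : Adversary P) :
    A.expectedOutcome =
      ex (A.viewDist P.rounds) fun v => if P.output (A.transcript v) = true then 1 else 0 :=
  map_apply_toReal _ _ _

/-- One of the two adversaries, downward or upward, succeeds: `v` is the threshold for the value of
the downward game. -/
theorem exists_adversary_dichotomy {lam η γ t v ζ : ℝ} (hl : 0 < lam) (hη : 0 ≤ η)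
    (hβ : η * lam ≤ 1 / 2) (hγ : 0 < γ) (ht : 0 ≤ t) (hlt : 1 ≤ lam * t) (hζ : 0 < ζ)
    (hv : 0 ≤ v) :
    ∃ A : Adversary P, A.IsAdaptive t ∧ (A.expectedOutcome ≤ v + ζ ∨
      1 - (Real.exp (-(η / 2) * v) + lam * η / (2 * γ) + lam * n * (η * lam + γ)) - ζ ≤
        A.expectedOutcome) := by
  set G : List M → ℝ := fun x => if P.output x = true then 1 else 0 with hGdef
  have hG : ∀ x, G x = 0 ∨ G x = 1 := fun x => by
    by_cases h : P.output x = true <;> simp [hGdef, h]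
  have hG0 : ∀ x, 0 ≤ G x := fun x => by rcases hG x with h | h <;> rw [h]; exact zero_le_one
  have hG1 : ∀ x, G x ≤ 1 := fun x => by rcases hG x with h | h <;> rw [h]; exact zero_le_one
  have hH0 : ∀ x, 0 ≤ 1 - G x := fun x => sub_nonneg.2 (hG1 x)
  have hH1 : ∀ x, 1 - G x ≤ 1 := fun x => by linarith [hG0 x]
  rcases le_or_gt (1 - value P lam (fun x => 1 - G x) P.rounds [] ∅) v with h | h
  · obtain ⟨A, hA, hval⟩ := exists_adversary_value_le P hl.le ht hlt hζ hH0 hH1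
    refine ⟨A, hA, Or.inl ?_⟩
    have hadd := ex_add (A.viewDist P.rounds) (f := fun v => 1 - G (A.transcript v))
      (g := fun v => G (A.transcript v)) (fun v => (abs_of_nonneg (hH0 _)).trans_le (hH1 _))
      (fun v => (abs_of_nonneg (hG0 _)).trans_le (hG1 _))
    simp only [sub_add_cancel, ex_const] at hadd
    rw [expectedOutcome_eq_ex]
    linarith
  · obtain ⟨A, hA, hval⟩ := exists_adversary_value_le P hl.le ht hlt hζ hG0 hG1
    refine ⟨A, hA, Or.inr ?_⟩
    -- Starting with every party surely honest makes the initial excess zero and the mixture the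
    -- value at `∅`.
    have hmix := one_sub_potential_le_mix P hl hη hβ hγ hG P.rounds [] (fun _ => 1)
      fun _ => ⟨zero_le_one, le_rfl⟩
    rw [mix_one] at hmix
    generalize 1 - value P lam (fun x => 1 - G x) P.rounds [] ∅ = w at h hmix
    have hβ0 : 0 ≤ η * lam := by positivity
    have hex : excess (η * lam) 1 = 0 := by simp [excess, hβ0]
    have hexp : Real.exp (-(η / 2) * w) ≤ Real.exp (-(η / 2) * v) :=
      Real.exp_le_exp.2 (by nlinarith)
    have hmu : lam * η / (2 * γ) * (1 - w) ≤ lam * η / (2 * γ) * 1 :=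
      mul_le_mul_of_nonneg_left (by linarith) (by positivity)
    simp only [potential, hex, zero_div, add_zero, Finset.sum_const, Finset.card_univ,
      Fintype.card_fin, nsmul_eq_mul, ← mul_assoc] at hmix
    rw [expectedOutcome_eq_ex]
    linarith

end Dichotomy

/-! ### Numerical estimates -/

section Parameters

theorem IsAdaptive.mono {n : ℕ} {M : Type} {P : Protocol n M} {A : Adversary P} {t t' : ℝ}
    (hA : A.IsAdaptive t) (h : t ≤ t') : A.IsAdaptive t' :=
  ⟨fun v hv => (hA.1 v hv).trans h, hA.2⟩

theorem three_halves_le_logb {n : ℕ} (hn : 3 ≤ n) : 3 / 2 ≤ Real.logb 2 n := by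
  rw [Real.le_logb_iff_rpow_le one_lt_two (by positivity)]
  have h : (2 : ℝ) ^ (3 / 2 : ℝ) ≤ 3 := by
    rw [← Real.sqrt_sq (show (0 : ℝ) ≤ 3 by norm_num), Real.le_sqrt' (by positivity),
      ← Real.rpow_natCast, ← Real.rpow_mul (by norm_num)]
    norm_num
  exact h.trans (by exact_mod_cast hn)

theorem epsilon_pos {n : ℕ} (hn : 3 ≤ n) : 0 < epsilon n := by
  have hL := three_halves_le_logb hn
  exact one_div_pos.2 (Real.rpow_pos_of_pos (Real.logb_pos one_lt_two (by linarith)) _)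

theorem one_le_logb_mul_epsilon_sq {n : ℕ} (hn : 3 ≤ n) :
    1 ≤ Real.logb 2 n * epsilon n ^ 2 := by
  have hL := three_halves_le_logb hn
  set L := Real.logb 2 (n : ℝ)
  have hl : 0 < Real.logb 2 L := Real.logb_pos one_lt_two (by linarith)
  have hlL : Real.logb 2 L ≤ L := by
    rw [Real.logb_le_iff_le_rpow one_lt_two (by linarith)]
    have h := one_add_mul_self_le_rpow_one_add (s := 1) (by norm_num) (p := L) (by linarith)
    norm_num at h
    linarith
  have hpow : (Real.logb 2 L ^ ((1 : ℝ) / 50)) ^ 2 ≤ L := by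
    rw [← Real.rpow_natCast, ← Real.rpow_mul hl.le]
    rcases le_total (Real.logb 2 L) 1 with h | h
    · exact (Real.rpow_le_one hl.le h (by norm_num)).trans (by linarith)
    · refine le_trans ?_ hlL
      calc _ ≤ Real.logb 2 L ^ (1 : ℝ) := Real.rpow_le_rpow_of_exponent_le h (by norm_num)
        _ = _ := Real.rpow_one _
  rw [epsilon, one_div, inv_pow, ← div_eq_mul_inv, one_le_div (by positivity)]
  exact hpow

theorem exp_neg_le_inv {z : ℝ} (hz : 0 < z) : Real.exp (-z) ≤ z⁻¹ := by
  rw [Real.exp_neg]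
  exact inv_anti₀ hz (by linarith [Real.add_one_le_exp z])

end Parameters

end

end CoinFlip

theorem theorem1p1 :
    ∃ C : ℝ, 0 < C ∧
      ∀ n : ℕ, 3 ≤ n → ∀ (M : Type) (P : CoinFlip.Protocol n M),
        ∃ A : CoinFlip.Adversary P,
          A.IsAdaptive (C * (Real.sqrt n * Real.logb 2 n ^ 3)) ∧
          (A.expectedOutcome ≤ CoinFlip.epsilon n ∨
            1 - C * CoinFlip.epsilon n ≤ A.expectedOutcome) := by
  -- The errors add up to at most `7 * ε`: `4 * ε` from the exponential, `ε / 2` from the weight of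
  -- `1 - v`, `2 * ε` from the corruption price and `ε / 2` from `ζ`.
  refine ⟨8, by norm_num, fun n hn M P => ?_⟩
  have hL := CoinFlip.three_halves_le_logb hn
  have hε := CoinFlip.epsilon_pos hn
  have hLε := CoinFlip.one_le_logb_mul_epsilon_sq hn
  generalize Real.logb 2 (n : ℝ) = L at *
  generalize CoinFlip.epsilon n = ε at *
  have hr2 : Real.sqrt n ^ 2 = (n : ℝ) := Real.sq_sqrt (Nat.cast_nonneg n)
  have hr1 : 1 ≤ Real.sqrt n := Real.one_le_sqrt.2 (by exact_mod_cast (by omega : 1 ≤ n))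
  generalize Real.sqrt n = r at *
  have hr0 : 0 < r := by linarith
  have hL0 : 0 < L := by linarith
  have hrL : r * L ^ 3 ≠ 0 := by positivity
  have hL2 : 9 / 4 ≤ L ^ 2 := by nlinarith
  have hLinv : L⁻¹ ≤ ε ^ 2 := by
    rw [inv_le_iff_one_le_mul₀' hL0]
    exact hLε
  have hβ : L * (r * L ^ 3)⁻¹ = r⁻¹ * (L ^ 2)⁻¹ := by field_simp
  have hr_inv : r⁻¹ ≤ 1 := inv_le_one_of_one_le₀ hr1
  have hL_inv : (L ^ 2)⁻¹ ≤ 4 / 9 := by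
    rw [inv_le_comm₀ (by positivity) (by norm_num)]
    linarith
  -- Here `lam * t = 1`. With `γ = r⁻¹` the factor `n` cancels: `lam * n * γ = L⁻¹ ^ 3` and `lam * η
  -- / (2 * γ) = (L ^ 2)⁻¹ / 2`, while `η = L` makes the exponential small because `L * ε ^ 2 ≥ 1`.
  obtain ⟨A, hA, h⟩ := CoinFlip.exists_adversary_dichotomy P (lam := (r * L ^ 3)⁻¹) (η := L)
    (γ := r⁻¹) (t := r * L ^ 3) (v := ε / 2) (ζ := ε / 2) (by positivity) hL0.le
    (by rw [hβ]; nlinarith [inv_pos.2 hr0, inv_pos.2 (pow_pos hL0 2)]) (by positivity)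
    (by positivity) (inv_mul_cancel₀ hrL).ge (by positivity) (by positivity)
  have hpos : 0 ≤ r * L ^ 3 := by positivity
  refine ⟨A, CoinFlip.IsAdaptive.mono hA (by linarith), h.imp (fun h => by linarith) fun h => ?_⟩
  have hexp : Real.exp (-(L / 2) * (ε / 2)) ≤ 4 * ε := by
    have h1 := CoinFlip.exp_neg_le_inv (z := L * ε / 4) (by positivity)
    have h2 : (L * ε / 4)⁻¹ = 4 * (L⁻¹ / ε) := by field_simp
    have h3 : L⁻¹ / ε ≤ ε := by
      rw [div_le_iff₀ hε]
      nlinarith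
    rw [show -(L / 2) * (ε / 2) = -(L * ε / 4) by ring]
    linarith
  have hsq : (L ^ 2)⁻¹ ≤ ε := by
    have h1 : L⁻¹ ≤ 1 := inv_le_one_of_one_le₀ (by linarith)
    have h2 : 0 < L⁻¹ := inv_pos.2 hL0
    rw [← inv_pow]
    refine (pow_le_pow_iff_left₀ (by positivity) hε.le two_ne_zero).1 ?_
    rw [← pow_mul]
    exact (pow_le_of_le_one h2.le h1 (by norm_num)).trans hLinv
  have hmu : (r * L ^ 3)⁻¹ * L / (2 * r⁻¹) = (L ^ 2)⁻¹ / 2 := by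
    field_simp
  have hcost : (r * L ^ 3)⁻¹ * n * (L * (r * L ^ 3)⁻¹ + r⁻¹) ≤ 2 * (L ^ 2)⁻¹ := by
    have e : (r * L ^ 3)⁻¹ * n * (L * (r * L ^ 3)⁻¹ + r⁻¹) =
        (L ^ 2)⁻¹ * (L⁻¹ * ((L ^ 2)⁻¹ + 1)) := by
      rw [← hr2]
      field_simp
    have h1 : L⁻¹ ≤ 1 := inv_le_one_of_one_le₀ (by linarith)
    have h2 : L⁻¹ * ((L ^ 2)⁻¹ + 1) ≤ 1 * 2 :=
      mul_le_mul h1 (by linarith) (by positivity) zero_le_one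
    rw [e]
    nlinarith [inv_pos.2 (pow_pos hL0 2)]
  rw [hmu] at h
  linarith
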